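/- Let $\Lambda=\{-1,0,1\}$, $\rho=\frac13(\delta_{-1}+\delta_0+\delta_1)$, and let $P_n$ be the product measure on $\Lambda^n$ with marginals $\rho$. For $\beta>0$, $K>0$ and $\omega\in\Lambda^n$ put $S_n(\omega)=\sum_{j=1}^n\omega_j$ and $$h_{n,K}(\omega)=\frac1n\sum_{j=1}^n\omega_j^2-K\Big(\frac{S_n(\omega)}n\Big)^2,\qquad P_{n,\beta,K}(d\omega)=\frac{e^{-n\beta h_{n,K}(\omega)}}{\int_{\Lambda^n}e^{-n\beta h_{n,K}}\,dP_n}\,P_n(d\omega)$$ (the mean-field Blume--Emery--Griffiths model). Let $\rho_\beta(dx)=e^{-\beta x^2}\rho(dx)/\int_\Lambda e^{-\beta y^2}\rho(dy)$, $c_\beta(t)=\log\int_\Lambda e^{tx}\rho_\beta(dx)$, $J_\beta(z)=\sup_{t\in\mathbb R}\{tz-c_\beta(t)\}$ and $G_{\beta,K}(z)=\beta Kz^2-c_\beta(2\beta Kz)$. Let $\tilde{\mathcal E}_{\beta,K}$ be the set of points $z\in[-1,1]$ that minimize $J_\beta(z)-\beta Kz^2$ over $[-1,1]$. Then $\tilde{\mathcal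 E}_{\beta,K}$ equals the set of global minimum points of $G_{\beta,K}$ on $\mathbb R$. Moreover, suppose that $\tilde{\mathcal E}_{\beta,K}=\{z_1,\dots,z_m\}$ with $m=2$ or $m=3$ distinct points. Then for each $j=1,\dots,m$ we have $G_{\beta,K}''(z_j)>0$, the quantity $$\sigma_j^2=\frac{2\beta K\,c_\beta''(2\beta Kz_j)}{G_{\beta,K}''(z_j)}$$ is positive, and there exists $A=A(z_j)>0$ such that for every $a\in(0,A)$ the event $\{S_n/n\in[z_j-a,z_j+a]\}$ has positive $P_{n,\beta,K}$-probability for all sufficiently large $n$, and, as $n\to\infty$, the conditional distributions $$P_{n,\beta,K}\Big\{\frac{S_n-nz_j}{n^{1/2}}\in dx\;\Big|\;\frac{S_n}{n}\in[z_j-a,z_j+a]\Big\}$$ converge weakly to the normal distribution $N(0,\sigma_j^2)$. -/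

import Mathlib

open MeasureTheory ProbabilityTheory Filter Topology

noncomputable section

namespace BEG

/-- The single-site state space `Λ = {-1, 0, 1} ⊂ ℝ`. -/
abbrev Spin : Type := ↥({-1, 0, 1} : Finset ℝ)

/-- The configuration space `Λⁿ`; its product σ-algebra consists of all subsets. -/
abbrev Config (n : ℕ) : Type := Fin n → Spin

/-- The uniform measure `ρ = (δ₋₁ + δ₀ + δ₁) / 3` on `Λ`. -/
def rho : Measure Spin := (3 : ENNReal)⁻¹ • ∑ x : Spin, Measure.dirac x

/-- The `n`-fold product measure `Pₙ` on `Λⁿ` with one-dimensional marginals `ρ`. -/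
def productMeasure (n : ℕ) : Measure (Config n) := Measure.pi fun _ => rho

/-- The total spin `Sₙ(ω) = ∑ ωⱼ`. -/
def totalSpin {n : ℕ} (ω : Config n) : ℝ := ∑ j, (ω j : ℝ)

/-- The Hamiltonian `Hₙ(ω) = ∑ ωⱼ² - (K / n) (∑ ωⱼ)²`. -/
def hamiltonian (K : ℝ) {n : ℕ} (ω : Config n) : ℝ :=
  ∑ j, (ω j : ℝ) ^ 2 - K / n * (∑ j, (ω j : ℝ)) ^ 2

/-- The energy per particle `hₙ = Hₙ / n`. -/
def energyPerParticle (K : ℝ) {n : ℕ} (ω : Config n) : ℝ :=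
  hamiltonian K ω / n

/-- The partition function `Zₙ(β, K) = ∫ exp(-n β hₙ) dPₙ`. -/
def partitionFunction (β K : ℝ) (n : ℕ) : ℝ :=
  ∫ ω : Config n, Real.exp (-(n * β * energyPerParticle K ω)) ∂(productMeasure n)

/-- The canonical ensemble, `Pₙ,β,K(dω) = Zₙ(β, K)⁻¹ exp(-n β hₙ(ω)) Pₙ(dω)`. -/
def canonicalEnsemble (β K : ℝ) (n : ℕ) : Measure (Config n) :=
  (productMeasure n).withDensity fun ω =>
    ENNReal.ofReal (Real.exp (-(n * β * energyPerParticle K ω)) / partitionFunction β K n)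

/-- `ρ_β(dω) = Z(β)⁻¹ exp(-β ω²) ρ(dω)` with `Z(β) = ∫ exp(-β ω²) dρ`. -/
def rhoBeta (β : ℝ) : Measure Spin :=
  rho.withDensity fun x =>
    ENNReal.ofReal (Real.exp (-(β * (x : ℝ) ^ 2)) / ∫ y : Spin, Real.exp (-(β * (y : ℝ) ^ 2)) ∂rho)

/-- The cumulant generating function `c_β(t) = log ∫ exp(t ω) ρ_β(dω)`. -/
def cumulant (β t : ℝ) : ℝ := cgf (fun x : Spin => (x : ℝ)) (rhoBeta β) t

/-- The Cramér rate function `J_β(z) = sup_t (t z - c_β(t))`. It is only used for `z ∈ [-1, 1]`,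
where the supremum is finite. -/
def rateJ (β z : ℝ) : ℝ := ⨆ t : ℝ, (t * z - cumulant β t)

/-- The set of canonical equilibrium macrostates for the spin per site:
the points of `[-1, 1]` that minimize `J_β(z) - β K z²` over `[-1, 1]`. -/
def macrostates (β K : ℝ) : Set ℝ :=
  {z | z ∈ Set.Icc (-1) 1 ∧
    ∀ y ∈ Set.Icc (-1 : ℝ) 1, rateJ β z - β * K * z ^ 2 ≤ rateJ β y - β * K * y ^ 2}

/-- `G_{β,K}(z) = β K z² - c_β(2 β K z)`. -/
def freeG (β K z : ℝ) : ℝ := β * K * z ^ 2 - cumulant β (2 * β * K * z)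

/-- `σ²(z) = 2 β K c_β''(2 β K z) / G_{β,K}''(z)`. -/
def limitVariance (β K z : ℝ) : ℝ :=
  2 * β * K * iteratedDeriv 2 (cumulant β) (2 * β * K * z) / iteratedDeriv 2 (freeG β K) z

/-- The event `Sₙ / n ∈ [z - a, z + a]`. -/
def spinEvent (z a : ℝ) (n : ℕ) : Set (Config n) :=
  {ω | totalSpin ω / n ∈ Set.Icc (z - a) (z + a)}

/-- The distribution of `(Sₙ - n z) / √n` under the canonical ensemble conditioned on
`Sₙ / n ∈ [z - a, z + a]`. It is the zero measure when that event is null. -/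
def condLaw (β K z a : ℝ) (n : ℕ) : FiniteMeasure ℝ :=
  ⟨(cond (canonicalEnsemble β K n) (spinEvent z a n)).map
      fun ω => (totalSpin ω - n * z) / Real.sqrt n, inferInstance⟩

/-- The normal distribution `N(0, v)`. -/
def normalLaw (v : ℝ) : FiniteMeasure ℝ :=
  ⟨gaussianReal 0 v.toNNReal, inferInstance⟩

end BEG

end

namespace BEG

/-! The equality of minimizers is Legendre duality. Taking `t = 2βKz` in the supremum gives `G(z) ≤
J(z) - βKz²`. Conversely, the dual point `w = c'(2βKy)` satisfies `J(w) - βKw² ≤ G(y)`. A minimizer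
of `G` solves `c'(2βKz) = z`, so there the dual point is `z` itself.

Nondegeneracy uses `G''(z) = 2βK(1 - 2βK c''(2βKz))` and the explicit `c(t) = log(1 + 2e^{-β} cosh
t) + const`. Suppose `G'' = 0` at a minimizer, by evenness with `z ≥ 0`. Either `c''` is strictly
larger on one side of `2βKz`, so that `G` decreases away from `z` on that side, or `c''` is globally
maximal there (`cumulantDeriv₂_le_or_lt`). In the latter case `G` is convex, and two minimizers
would force an interval of them, against finiteness.

For the limit law, the ensemble is the product of tilted site laws with mean `z` and variance `v =
c''(2βKz)`, reweighted by `exp(βK W²)`, where `W = (S - nz)/√n` (`canonicalEnsemble_eq_tilted`). The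
central limit theorem gives `W → N(0, v)`. Since `G'' > 0` means `2βKv < 1`, the weight turns this
Gaussian into a multiple of `N(0, v/(1 - 2βKv))`, whose variance is `σ²`. The weight is unbounded,
but the conditioning event is `|W| ≤ a√n`. For small `a` a Chernoff bound there controls a slightly
larger exponential square moment uniformly in `n`, so the limit passes through the weight.
Normalizing constants cancel in the conditional law. -/

lemma integral_rho (f : Spin → ℝ) :
    ∫ x, f x ∂rho = (f ⟨-1, by simp⟩ + f ⟨0, by simp⟩ + f ⟨1, by simp⟩) / 3 := by
  have h : ∑ x : Spin, f x = f ⟨-1, by simp⟩ + f ⟨0, by simp⟩ + f ⟨1, by simp⟩ := by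
    have hu : (Finset.univ : Finset Spin) =
        {⟨-1, by simp⟩, ⟨0, by simp⟩, ⟨1, by simp⟩} := by
      ext ⟨x, hx⟩
      have h : x = -1 ∨ x = 0 ∨ x = 1 := by simpa using hx
      rcases h with rfl | rfl | rfl <;> simp
    rw [hu, Finset.sum_insert (by norm_num), Finset.sum_insert (by norm_num),
      Finset.sum_singleton, add_assoc]
  rw [rho, integral_smul_measure, integral_finsetSum_measure (fun _ _ => Integrable.of_finite)]
  simp only [integral_dirac, h]
  simp
  ring

instance : IsProbabilityMeasure rho := by
  refine ⟨?_⟩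
  have : ((Finset.univ : Finset Spin).card : ENNReal) = 3 := by
    rw [Finset.card_univ, Fintype.card_coe]
    norm_num [Finset.card_insert_of_notMem]
  simp only [rho, Measure.smul_apply, Measure.finsetSum_apply, measure_univ, Finset.sum_const,
    smul_eq_mul, nsmul_eq_mul, mul_one, this]
  exact ENNReal.inv_mul_cancel (by norm_num) (by norm_num)

/-! ### The cumulant generating function in closed form. -/

lemma rhoBeta_eq_tilted (β : ℝ) :
    rhoBeta β = rho.tilted fun x : Spin => -(β * (x : ℝ) ^ 2) := rfl

instance (β : ℝ) : IsProbabilityMeasure (rhoBeta β) :=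
  isProbabilityMeasure_tilted Integrable.of_finite

/-- The unnormalised moment generating function `1 + 2 e^{-β} cosh t` of the single-site law. -/
noncomputable def siteMgf (β t : ℝ) : ℝ := 1 + 2 * Real.exp (-β) * Real.cosh t

lemma one_lt_siteMgf (β t : ℝ) : 1 < siteMgf β t := by
  have := mul_pos (Real.exp_pos (-β)) (Real.cosh_pos t)
  unfold siteMgf
  linarith

lemma siteMgf_pos (β t : ℝ) : 0 < siteMgf β t := one_pos.trans (one_lt_siteMgf β t)

lemma mgf_rhoBeta (β t : ℝ) :
    mgf (fun x : Spin => (x : ℝ)) (rhoBeta β) t = siteMgf β t / siteMgf β 0 := by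
  have h0 := siteMgf_pos β 0
  rw [mgf, rhoBeta_eq_tilted, integral_exp_tilted, integral_rho, integral_rho]
  simp only [Pi.add_apply]
  simp only [siteMgf, Real.cosh_eq] at h0 ⊢
  simp only [neg_zero, Real.exp_zero] at h0 ⊢
  norm_num [Real.exp_add] at h0 ⊢
  rw [div_eq_div_iff (by positivity) (by positivity)]
  ring

lemma cumulant_eq (β t : ℝ) :
    cumulant β t = Real.log (siteMgf β t) - Real.log (siteMgf β 0) := by
  rw [cumulant, cgf, mgf_rhoBeta, Real.log_div (siteMgf_pos _ _).ne' (siteMgf_pos _ _).ne']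

/-- The derivative of `cumulant β`. -/
noncomputable def cumulantDeriv (β t : ℝ) : ℝ := 2 * Real.exp (-β) * Real.sinh t / siteMgf β t

/-- The second derivative of `cumulant β`. -/
noncomputable def cumulantDeriv₂ (β t : ℝ) : ℝ :=
  (2 * Real.exp (-β) * Real.cosh t + 4 * Real.exp (-β) ^ 2) / siteMgf β t ^ 2

lemma hasDerivAt_siteMgf (β t : ℝ) :
    HasDerivAt (siteMgf β) (2 * Real.exp (-β) * Real.sinh t) t :=
  ((Real.hasDerivAt_cosh t).const_mul _).const_add _

lemma hasDerivAt_cumulant (β t : ℝ) : HasDerivAt (cumulant β) (cumulantDeriv β t) t := by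
  have h := ((hasDerivAt_siteMgf β t).log (siteMgf_pos β t).ne').sub_const
    (Real.log (siteMgf β 0))
  exact h.congr_of_eventuallyEq (Eventually.of_forall (cumulant_eq β))

lemma hasDerivAt_cumulantDeriv (β t : ℝ) :
    HasDerivAt (cumulantDeriv β) (cumulantDeriv₂ β t) t := by
  have h := ((Real.hasDerivAt_sinh t).const_mul (2 * Real.exp (-β))).div
    (hasDerivAt_siteMgf β t) (siteMgf_pos β t).ne'
  convert! h using 1
  rw [cumulantDeriv₂, siteMgf]
  congr 1
  linear_combination (-4 * Real.exp (-β) ^ 2) * Real.cosh_sq t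

lemma cumulantDeriv₂_pos (β t : ℝ) : 0 < cumulantDeriv₂ β t := by
  have := Real.cosh_pos t
  have := siteMgf_pos β t
  unfold cumulantDeriv₂
  positivity

lemma iteratedDeriv_two_cumulant (β t : ℝ) :
    iteratedDeriv 2 (cumulant β) t = cumulantDeriv₂ β t := by
  rw [iteratedDeriv_succ, iteratedDeriv_one,
    show deriv (cumulant β) = cumulantDeriv β from
      funext fun t => (hasDerivAt_cumulant β t).deriv]
  exact (hasDerivAt_cumulantDeriv β t).deriv

/-! ### Convexity and Legendre duality. -/

lemma convexOn_cumulant (β : ℝ) : ConvexOn ℝ Set.univ (cumulant β) := by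
  refine convexOn_of_hasDerivWithinAt2_nonneg convex_univ
    (fun t _ => (hasDerivAt_cumulant β t).continuousAt.continuousWithinAt)
    (fun t _ => (hasDerivAt_cumulant β t).hasDerivWithinAt)
    (fun t _ => (hasDerivAt_cumulantDeriv β t).hasDerivWithinAt)
    (fun t _ => (cumulantDeriv₂_pos β t).le)

lemma cumulant_tangent_le (β s t : ℝ) :
    cumulant β t + cumulantDeriv β t * (s - t) ≤ cumulant β s := by
  have hc := convexOn_cumulant β
  rcases lt_trichotomy s t with h | rfl | h
  · have := hc.slope_le_of_hasDerivAt (Set.mem_univ s) (Set.mem_univ t) h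
      (hasDerivAt_cumulant β t)
    rw [slope_def_field, div_le_iff₀ (sub_pos.2 h)] at this
    linarith
  · simp
  · have := hc.le_slope_of_hasDerivAt (Set.mem_univ t) (Set.mem_univ s) h
      (hasDerivAt_cumulant β t)
    rw [slope_def_field, le_div_iff₀ (sub_pos.2 h)] at this
    linarith

/-- Makes every dual point `c'(2βKy)` a competitor in the minimization over `[-1, 1]`. -/
lemma abs_cumulantDeriv_le (β t : ℝ) : |cumulantDeriv β t| ≤ 1 := by
  have hb := Real.exp_pos (-β)
  have h1 : |Real.sinh t| ≤ Real.cosh t := by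
    rw [abs_le, Real.sinh_eq, Real.cosh_eq]
    constructor <;> linarith [Real.exp_pos t, Real.exp_pos (-t)]
  rw [cumulantDeriv, abs_div, abs_of_pos (siteMgf_pos β t), div_le_one (siteMgf_pos β t), abs_mul,
    abs_of_pos (by positivity), siteMgf]
  nlinarith

/-- One exponential of the cosh gives `siteMgf β t ≥ e^{|t| - β}`, so `c` grows at least like `|t|`
and beats `tz`. Without boundedness the real supremum would be a default value. -/
lemma bddAbove_range_rateJ (β : ℝ) {z : ℝ} (hz : z ∈ Set.Icc (-1 : ℝ) 1) :
    BddAbove (Set.range fun t : ℝ => t * z - cumulant β t) := by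
  refine ⟨β + Real.log (siteMgf β 0), ?_⟩
  rintro _ ⟨t, rfl⟩
  have h : |t| - β ≤ Real.log (siteMgf β t) := by
    rw [Real.le_log_iff_exp_le (siteMgf_pos β t), siteMgf, ← Real.cosh_abs, Real.cosh_eq,
      sub_eq_add_neg, Real.exp_add]
    have := mul_pos (Real.exp_pos (-β)) (Real.exp_pos (-|t|))
    nlinarith
  have h2 : t * z ≤ |t| := by
    calc t * z ≤ |t * z| := le_abs_self _
      _ = |t| * |z| := abs_mul _ _
      _ ≤ |t| * 1 := by gcongr; exact abs_le.2 hz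
      _ = |t| := mul_one _
  simp only [cumulant_eq]
  linarith

lemma le_rateJ (β t : ℝ) {z : ℝ} (hz : z ∈ Set.Icc (-1 : ℝ) 1) :
    t * z - cumulant β t ≤ rateJ β z :=
  le_ciSup (bddAbove_range_rateJ β hz) t

/-- The tangent line at `t` lies below the convex `c`, so the supremum at slope `c'(t)` is attained
at `t`. -/
lemma rateJ_cumulantDeriv_le (β t : ℝ) :
    rateJ β (cumulantDeriv β t) ≤ t * cumulantDeriv β t - cumulant β t :=
  ciSup_le fun s => by linarith [cumulant_tangent_le β s t]

lemma freeG_le_rateJ_sub (β K : ℝ) {z : ℝ} (hz : z ∈ Set.Icc (-1 : ℝ) 1) :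
    freeG β K z ≤ rateJ β z - β * K * z ^ 2 := by
  have := le_rateJ β (2 * β * K * z) hz
  rw [freeG]
  linarith

/-- After the tangent bound the gap is the perfect square `βK(y - c'(2βKy))²`. -/
lemma rateJ_sub_le_freeG {β K : ℝ} (hβ : 0 < β) (hK : 0 < K) (y : ℝ) :
    rateJ β (cumulantDeriv β (2 * β * K * y)) - β * K * cumulantDeriv β (2 * β * K * y) ^ 2
      ≤ freeG β K y := by
  have h := rateJ_cumulantDeriv_le β (2 * β * K * y)
  have h2 : 0 ≤ β * K * (y - cumulantDeriv β (2 * β * K * y)) ^ 2 := by positivity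
  rw [freeG]
  linarith

lemma hasDerivAt_freeG (β K z : ℝ) :
    HasDerivAt (freeG β K) (2 * β * K * (z - cumulantDeriv β (2 * β * K * z))) z := by
  have h1 := (hasDerivAt_cumulant β (2 * β * K * z)).comp z
    ((hasDerivAt_id z).const_mul (2 * β * K))
  have h2 := ((hasDerivAt_id z).pow 2).const_mul (β * K)
  convert! h2.sub h1 using 1
  simp
  ring

/-- The second derivative of `freeG β K`. -/
noncomputable def freeGDeriv₂ (β K z : ℝ) : ℝ :=
  2 * β * K * (1 - 2 * β * K * cumulantDeriv₂ β (2 * β * K * z))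

lemma hasDerivAt_freeG_deriv (β K z : ℝ) :
    HasDerivAt (fun z => 2 * β * K * (z - cumulantDeriv β (2 * β * K * z)))
      (freeGDeriv₂ β K z) z := by
  have h1 := (hasDerivAt_cumulantDeriv β (2 * β * K * z)).comp z
    ((hasDerivAt_id z).const_mul (2 * β * K))
  convert! ((hasDerivAt_id z).sub h1).const_mul (2 * β * K) using 1
  rw [freeGDeriv₂]
  ring

lemma iteratedDeriv_two_freeG (β K z : ℝ) :
    iteratedDeriv 2 (freeG β K) z = freeGDeriv₂ β K z := by
  rw [iteratedDeriv_succ, iteratedDeriv_one, show deriv (freeG β K) = _ from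
    funext fun t => (hasDerivAt_freeG β K t).deriv]
  exact (hasDerivAt_freeG_deriv β K z).deriv

lemma cumulantDeriv_eq_of_isMin {β K : ℝ} (hβ : 0 < β) (hK : 0 < K) {z : ℝ}
    (hz : ∀ y, freeG β K z ≤ freeG β K y) : cumulantDeriv β (2 * β * K * z) = z := by
  have h : IsLocalMin (freeG β K) z := Eventually.of_forall hz
  have h0 := h.hasDerivAt_eq_zero (hasDerivAt_freeG β K z)
  have : 2 * β * K ≠ 0 := by positivity
  have := (mul_eq_zero.1 h0).resolve_left this
  linarith

theorem macrostates_eq {β K : ℝ} (hβ : 0 < β) (hK : 0 < K) :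
    macrostates β K = {z : ℝ | ∀ y : ℝ, freeG β K z ≤ freeG β K y} := by
  ext z
  constructor
  · rintro ⟨hz, hmin⟩ y
    exact (freeG_le_rateJ_sub β K hz).trans
      ((hmin _ (abs_le.1 (abs_cumulantDeriv_le β (2 * β * K * y)))).trans
        (rateJ_sub_le_freeG hβ hK y))
  · intro hz
    have h := cumulantDeriv_eq_of_isMin hβ hK hz
    have h1 := rateJ_sub_le_freeG hβ hK z
    rw [h] at h1
    refine ⟨h ▸ abs_le.1 (abs_cumulantDeriv_le β _), fun y hy => ?_⟩
    exact h1.trans ((hz y).trans (freeG_le_rateJ_sub β K hy))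

/-! ### Nondegeneracy of the minimum points. -/

lemma siteMgf_neg (β t : ℝ) : siteMgf β (-t) = siteMgf β t := by simp [siteMgf]

lemma freeG_neg (β K z : ℝ) : freeG β K (-z) = freeG β K z := by
  simp [freeG, cumulant_eq, siteMgf_neg]

lemma freeGDeriv₂_neg (β K z : ℝ) : freeGDeriv₂ β K (-z) = freeGDeriv₂ β K z := by
  simp [freeGDeriv₂, cumulantDeriv₂, siteMgf_neg]

/-- The curvature is a quadratic polynomial in `1 / siteMgf β t`, which is itself strictly
decreasing in `|t|`; this reduces its shape to that of a parabola. -/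
lemma cumulantDeriv₂_eq (β t : ℝ) :
    cumulantDeriv₂ β t =
      (siteMgf β t)⁻¹ - (1 - 4 * Real.exp (-β) ^ 2) * (siteMgf β t)⁻¹ ^ 2 := by
  have := (siteMgf_pos β t).ne'
  rw [cumulantDeriv₂]
  field_simp
  rw [siteMgf]
  ring

lemma siteMgf_lt_siteMgf (β : ℝ) {s t : ℝ} (h : |s| < |t|) : siteMgf β s < siteMgf β t := by
  have := Real.cosh_lt_cosh.2 h
  unfold siteMgf
  gcongr

lemma siteMgf_le_siteMgf (β : ℝ) {s t : ℝ} (h : |s| ≤ |t|) : siteMgf β s ≤ siteMgf β t := by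
  have := Real.cosh_le_cosh.2 h
  unfold siteMgf
  gcongr

lemma continuous_inv_siteMgf (β : ℝ) : Continuous fun t => (siteMgf β t)⁻¹ :=
  (continuous_iff_continuousAt.2 fun t => (hasDerivAt_siteMgf β t).continuousAt).inv₀
    fun t => (siteMgf_pos β t).ne'

/-- The curvature `c_β''` is, at `t ≥ 0`, either globally maximal or strictly exceeded on
one side of `t`. -/
lemma cumulantDeriv₂_le_or_lt (β : ℝ) {t : ℝ} (ht : 0 ≤ t) :
    (∀ s, cumulantDeriv₂ β s ≤ cumulantDeriv₂ β t) ∨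
    (∀ᶠ s in 𝓝[>] t, cumulantDeriv₂ β t < cumulantDeriv₂ β s) ∨
    (∀ᶠ s in 𝓝[<] t, cumulantDeriv₂ β t < cumulantDeriv₂ β s) := by
  set d := 1 - 4 * Real.exp (-β) ^ 2 with hd
  have hd1 : d ≤ 1 := by
    have := sq_nonneg (Real.exp (-β))
    linarith
  have key : ∀ s, cumulantDeriv₂ β s - cumulantDeriv₂ β t =
      ((siteMgf β s)⁻¹ - (siteMgf β t)⁻¹) * (1 - d * ((siteMgf β s)⁻¹ + (siteMgf β t)⁻¹)) := by
    intro s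
    rw [cumulantDeriv₂_eq, cumulantDeriv₂_eq]
    ring
  have hcont : Continuous fun s => 1 - d * ((siteMgf β s)⁻¹ + (siteMgf β t)⁻¹) :=
    continuous_const.sub (((continuous_inv_siteMgf β).add continuous_const).const_mul d)
  have hv : 0 < (siteMgf β t)⁻¹ := inv_pos.2 (siteMgf_pos β t)
  -- This is the slope of the parabola at `1 / siteMgf β t`. Negative: curvature grows to the right
  -- of `t`. Zero: `t` sits at the vertex, a maximum because `d > 0`. Positive: it grows to the
  -- left, unless `t = 0`, where `1 / siteMgf` is already largest.
  rcases lt_trichotomy (1 - d * ((siteMgf β t)⁻¹ + (siteMgf β t)⁻¹)) 0 with h | h | h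
  · refine Or.inr (Or.inl ?_)
    have h1 := (hcont.continuousAt (x := t)).eventually_lt_const h
    filter_upwards [nhdsWithin_le_nhds h1, self_mem_nhdsWithin] with s hs hst
    have hst' : t < s := hst
    have h2 : (siteMgf β s)⁻¹ < (siteMgf β t)⁻¹ :=
      inv_strictAnti₀ (siteMgf_pos β t) (siteMgf_lt_siteMgf β (by
        rwa [abs_of_nonneg ht, abs_of_nonneg (ht.trans hst'.le)]))
    have := mul_pos_of_neg_of_neg (sub_neg.2 h2) hs
    linarith [key s]
  · refine Or.inl fun s => ?_
    have hdp : 0 < d := by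
      by_contra hneg
      nlinarith
    have : cumulantDeriv₂ β s - cumulantDeriv₂ β t =
        -(d * ((siteMgf β s)⁻¹ - (siteMgf β t)⁻¹) ^ 2) := by
      rw [key s]
      linear_combination ((siteMgf β s)⁻¹ - (siteMgf β t)⁻¹) * h
    have h2 : 0 ≤ d * ((siteMgf β s)⁻¹ - (siteMgf β t)⁻¹) ^ 2 := by positivity
    linarith
  · rcases ht.eq_or_lt with rfl | ht
    · refine Or.inl fun s => ?_
      have h2 : (siteMgf β s)⁻¹ ≤ (siteMgf β 0)⁻¹ :=
        inv_anti₀ (siteMgf_pos β 0) (siteMgf_le_siteMgf β (by simp))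
      have h3 : 0 < (siteMgf β s)⁻¹ := inv_pos.2 (siteMgf_pos β s)
      have h4 : 0 ≤ 1 - d * ((siteMgf β s)⁻¹ + (siteMgf β 0)⁻¹) := by
        rcases le_total d 0 with h0 | h0 <;> nlinarith
      have := mul_nonneg (sub_nonneg.2 h2) h4
      linarith [key s]
    · refine Or.inr (Or.inr ?_)
      have h1 := (hcont.continuousAt (x := t)).eventually_const_lt h
      have h0 := eventually_gt_nhds ht
      filter_upwards [nhdsWithin_le_nhds h1, nhdsWithin_le_nhds h0, self_mem_nhdsWithin]
        with s hs hs0 hst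
      have hst' : s < t := hst
      have h2 : (siteMgf β t)⁻¹ < (siteMgf β s)⁻¹ :=
        inv_strictAnti₀ (siteMgf_pos β s) (siteMgf_lt_siteMgf β (by
          rwa [abs_of_pos ht, abs_of_pos hs0]))
      have := mul_pos (sub_pos.2 h2) hs
      linarith [key s]

/-- A function whose derivative vanishes at `z` and whose second derivative is negative
immediately to the right of `z` takes smaller values than at `z`. -/
lemma exists_lt_of_deriv₂_neg_right {f f' f'' : ℝ → ℝ} (hf : ∀ x, HasDerivAt f (f' x) x)
    (hf' : ∀ x, HasDerivAt f' (f'' x) x) {z : ℝ} (hz : f' z = 0)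
    (h : ∀ᶠ x in 𝓝[>] z, f'' x < 0) : ∃ y, f y < f z := by
  obtain ⟨w, hzw, hw⟩ := mem_nhdsGT_iff_exists_Ioo_subset.1 h
  have hzw : z < w := hzw
  have h1 : StrictAntiOn f' (Set.Ico z w) := by
    refine strictAntiOn_of_deriv_neg (convex_Ico z w)
      (fun x _ => (hf' x).continuousAt.continuousWithinAt) fun x hx => ?_
    rw [interior_Ico] at hx
    rw [(hf' x).deriv]
    exact hw hx
  have h2 : StrictAntiOn f (Set.Ico z w) := by
    refine strictAntiOn_of_deriv_neg (convex_Ico z w)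
      (fun x _ => (hf x).continuousAt.continuousWithinAt) fun x hx => ?_
    rw [interior_Ico] at hx
    rw [(hf x).deriv, ← hz]
    exact h1 ⟨le_rfl, hzw⟩ ⟨hx.1.le, hx.2⟩ hx.1
  refine ⟨(z + w) / 2, h2 ⟨le_rfl, hzw⟩ ⟨?_, ?_⟩ ?_⟩ <;> linarith

lemma exists_lt_of_deriv₂_neg_left {f f' f'' : ℝ → ℝ} (hf : ∀ x, HasDerivAt f (f' x) x)
    (hf' : ∀ x, HasDerivAt f' (f'' x) x) {z : ℝ} (hz : f' z = 0)
    (h : ∀ᶠ x in 𝓝[<] z, f'' x < 0) : ∃ y, f y < f z := by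
  have hg : ∀ x, HasDerivAt (fun x => f (-x)) (-f' (-x)) x := fun x => by
    convert! (hf (-x)).comp x (hasDerivAt_neg x) using 1
    ring
  have hg' : ∀ x, HasDerivAt (fun x => -f' (-x)) (f'' (-x)) x := fun x => by
    convert! ((hf' (-x)).comp x (hasDerivAt_neg x)).neg using 1
    ring
  have hev : ∀ᶠ x in 𝓝[>] (-z), f'' (-x) < 0 := by
    have : Tendsto (fun x : ℝ => -x) (𝓝[>] (-z)) (𝓝[<] z) := by
      simpa using tendsto_neg_nhdsGT (a := -z)
    exact this.eventually h
  obtain ⟨y, hy⟩ := exists_lt_of_deriv₂_neg_right hg hg' (z := -z) (by simp [hz]) hev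
  exact ⟨-y, by simpa using hy⟩

lemma freeGDeriv₂_pos_of_nonneg {β K : ℝ} (hβ : 0 < β) (hK : 0 < K)
    (hfin : {z : ℝ | ∀ y : ℝ, freeG β K z ≤ freeG β K y}.Finite)
    (hnt : {z : ℝ | ∀ y : ℝ, freeG β K z ≤ freeG β K y}.Nontrivial) {z : ℝ} (hz0 : 0 ≤ z)
    (hz : ∀ y, freeG β K z ≤ freeG β K y) : 0 < freeGDeriv₂ β K z := by
  have hk : 0 < 2 * β * K := by positivity
  by_contra hneg
  have hcrit : 2 * β * K * (z - cumulantDeriv β (2 * β * K * z)) = 0 := by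
    rw [cumulantDeriv_eq_of_isMin hβ hK hz, sub_self, mul_zero]
  have hc : 1 ≤ 2 * β * K * cumulantDeriv₂ β (2 * β * K * z) := by
    by_contra h
    exact hneg (mul_pos hk (by linarith))
  have hlt : ∀ x, cumulantDeriv₂ β (2 * β * K * z) < cumulantDeriv₂ β (2 * β * K * x) →
      freeGDeriv₂ β K x < 0 := fun x hx =>
    mul_neg_of_pos_of_neg hk (by nlinarith)
  have hneg' : ∀ {l : Filter ℝ}, (∀ᶠ x in l, freeGDeriv₂ β K x < 0) →
      ((∀ᶠ x in l, freeGDeriv₂ β K x < 0) → ∃ y, freeG β K y < freeG β K z) → False :=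
    fun h1 h2 => (h2 h1).elim fun y hy => (hz y).not_gt hy
  have hmul : ContinuousAt (fun x : ℝ => 2 * β * K * x) z := by fun_prop
  -- Maximal curvature of `c` at a degenerate point makes `G'' ≥ 0` everywhere. The minimizers then
  -- form a convex set with two points, hence an infinite one.
  have hconv : freeGDeriv₂ β K z = 0 → (∀ s, cumulantDeriv₂ β s ≤
      cumulantDeriv₂ β (2 * β * K * z)) → False := by
    intro h0 hmax
    have hG : ConvexOn ℝ Set.univ (freeG β K) := by
      refine convexOn_of_hasDerivWithinAt2_nonneg convex_univ
        (fun t _ => (hasDerivAt_freeG β K t).continuousAt.continuousWithinAt)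
        (fun t _ => (hasDerivAt_freeG β K t).hasDerivWithinAt)
        (fun t _ => (hasDerivAt_freeG_deriv β K t).hasDerivWithinAt) (fun t _ => ?_)
      have h1 := (mul_eq_zero.1 h0).resolve_left hk.ne'
      exact mul_nonneg hk.le (by nlinarith [hmax (2 * β * K * t)])
    have hset : {z : ℝ | ∀ y : ℝ, freeG β K z ≤ freeG β K y} =
        {x ∈ Set.univ | freeG β K x ≤ freeG β K z} := by
      ext x
      exact ⟨fun h => ⟨trivial, h z⟩, fun h y => h.2.trans (hz y)⟩
    have hcv := hG.convex_le (freeG β K z)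
    rw [← hset] at hcv
    obtain ⟨x, hx, y, hy, hxy⟩ := hnt.exists_lt
    exact (Set.Icc_infinite hxy) (hfin.subset (hcv.ordConnected.out hx hy))
  -- A strictly negative value would persist to the right of `z` by continuity, and `G` would drop
  -- below its minimum.
  have hnn : freeGDeriv₂ β K z = 0 := by
    refine le_antisymm (not_lt.1 hneg) ?_
    by_contra hlt0
    have hcts : ContinuousAt (freeGDeriv₂ β K) z := by
      have h1 : Continuous (cumulantDeriv₂ β) := by
        rw [show cumulantDeriv₂ β = _ from funext (cumulantDeriv₂_eq β)]
        exact (continuous_inv_siteMgf β).sub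
          (continuous_const.mul ((continuous_inv_siteMgf β).pow 2))
      unfold freeGDeriv₂
      fun_prop
    have hev := hcts.eventually_lt_const (not_le.1 hlt0)
    exact hneg' (nhdsWithin_le_nhds (s := Set.Ioi z) hev)
      (exists_lt_of_deriv₂_neg_right (hasDerivAt_freeG β K) (hasDerivAt_freeG_deriv β K) hcrit)
  rcases cumulantDeriv₂_le_or_lt β (t := 2 * β * K * z) (by positivity) with h | h | h
  · exact hconv hnn h
  · have ht : Tendsto (fun x : ℝ => 2 * β * K * x) (𝓝[>] z) (𝓝[>] (2 * β * K * z)) :=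
      tendsto_nhdsWithin_iff.2 ⟨hmul.tendsto.mono_left nhdsWithin_le_nhds,
        eventually_mem_nhdsWithin.mono fun x hx => mul_lt_mul_of_pos_left hx hk⟩
    exact hneg' ((ht.eventually h).mono hlt)
      (exists_lt_of_deriv₂_neg_right (hasDerivAt_freeG β K) (hasDerivAt_freeG_deriv β K) hcrit)
  · have ht : Tendsto (fun x : ℝ => 2 * β * K * x) (𝓝[<] z) (𝓝[<] (2 * β * K * z)) :=
      tendsto_nhdsWithin_iff.2 ⟨hmul.tendsto.mono_left nhdsWithin_le_nhds,
        eventually_mem_nhdsWithin.mono fun x hx => mul_lt_mul_of_pos_left hx hk⟩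
    exact hneg' ((ht.eventually h).mono hlt)
      (exists_lt_of_deriv₂_neg_left (hasDerivAt_freeG β K) (hasDerivAt_freeG_deriv β K) hcrit)

/-- If `freeG β K` has at least two and finitely many global minimum points, they are all
nondegenerate. -/
theorem freeGDeriv₂_pos {β K : ℝ} (hβ : 0 < β) (hK : 0 < K)
    (hfin : {z : ℝ | ∀ y : ℝ, freeG β K z ≤ freeG β K y}.Finite)
    (hnt : {z : ℝ | ∀ y : ℝ, freeG β K z ≤ freeG β K y}.Nontrivial) {z : ℝ}
    (hz : ∀ y, freeG β K z ≤ freeG β K y) : 0 < freeGDeriv₂ β K z := by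
  rcases le_total 0 z with h | h
  · exact freeGDeriv₂_pos_of_nonneg hβ hK hfin hnt h hz
  · rw [← freeGDeriv₂_neg]
    exact freeGDeriv₂_pos_of_nonneg hβ hK hfin hnt (neg_nonneg.2 h)
      fun y => (freeG_neg β K z).trans_le (hz y)

/-! ### Central limit theorem and Gaussian tails for product measures. -/

section Product

variable {Ω : Type*} [MeasurableSpace Ω] {μ : Measure Ω} [IsProbabilityMeasure μ] {X : Ω → ℝ}

/-- The central limit theorem for finite products of a fixed probability measure. -/
theorem tendsto_map_pi_gaussianReal (hX : Measurable X) (hX2 : MemLp X 2 μ) :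
    Tendsto (fun n : ℕ => (⟨(Measure.pi fun _ : Fin n => μ).map
        fun ω => (∑ j, X (ω j) - n * ∫ x, X x ∂μ) / √n,
        Measure.isProbabilityMeasure_map (Measurable.aemeasurable (by fun_prop))⟩ :
          ProbabilityMeasure ℝ)) atTop
      (nhds (X := ProbabilityMeasure ℝ) ⟨gaussianReal 0 Var[X; μ].toNNReal, inferInstance⟩) := by
  have hXi : ∀ i : ℕ, Measurable fun ω : ℕ → Ω => X (ω i) := fun i => by fun_prop
  -- The finite products are marginals of one infinite product, where the i.i.d. central limit
  -- theorem applies.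
  set P := Measure.infinitePi fun _ : ℕ => μ with hP
  have hmp := measurePreserving_eval_infinitePi (fun _ : ℕ => μ)
  have hlaw : ∀ i : ℕ, P.map (fun ω => X (ω i)) = μ.map X := fun i => by
    rw [← (hmp i).map_eq, Measure.map_map hX (measurable_pi_apply i)]
    rfl
  have hid0 : IdentDistrib (fun ω : ℕ → Ω => X (ω 0)) X P μ :=
    ⟨(hXi 0).aemeasurable, hX.aemeasurable, hlaw 0⟩
  have h := tendstoInDistribution_inv_sqrt_mul_sum_sub (P := P)
    (X := fun i ω => X (ω i)) (Y := id) (P' := gaussianReal 0 Var[X; μ].toNNReal)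
    ⟨by fun_prop, by rw [Measure.map_id, hid0.variance_eq]⟩ (hid0.memLp_iff.2 hX2)
    (iIndepFun_infinitePi fun _ => hX)
    (fun i => ⟨(hXi i).aemeasurable, (hXi 0).aemeasurable, (hlaw i).trans (hlaw 0).symm⟩)
  have hlim := h.tendsto
  simp only [Measure.map_id] at hlim
  refine hlim.congr fun n => Subtype.ext ?_
  have hpi := Measure.map_infinitePi_infinitePi_of_inj (P := fun _ : ℕ => μ)
    (f := (Fin.val : Fin n → ℕ)) Fin.val_injective
  simp only [Measure.infinitePi_eq_pi] at hpi
  change Measure.map _ _ = Measure.map _ _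
  rw [← hpi, Measure.map_map (by fun_prop) (by fun_prop)]
  congr 1
  ext ω
  rw [Function.comp_apply, Fin.sum_univ_eq_sum_range (fun i => X (ω i)) n, hid0.integral_eq,
    div_eq_inv_mul]

/-- Second-order Taylor expansion of the cgf: value and slope vanish at `0`, and its second
derivative is continuous with value `Var X < τ` there. -/
lemma exists_mgf_le_exp_of_nonneg (hexp : ∀ t, Integrable (fun ω => Real.exp (t * X ω)) μ)
    (h0 : ∫ ω, X ω ∂μ = 0) {τ : ℝ} (hτ : Var[X; μ] < τ) :
    ∃ δ > 0, ∀ t, 0 ≤ t → t ≤ δ → mgf X μ t ≤ Real.exp (τ * t ^ 2 / 2) := by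
  have huniv : interior (integrableExpSet X μ) = Set.univ := by
    rw [show integrableExpSet X μ = Set.univ from Set.eq_univ_of_forall hexp, interior_univ]
  have hcont : ContinuousAt (iteratedDeriv 2 (cgf X μ)) 0 := by
    have h1 := (analyticOnNhd_cgf (X := X) (μ := μ)).iterated_deriv 2 0 (huniv ▸ Set.mem_univ _)
    rw [iteratedDeriv_eq_iterate]
    exact h1.continuousAt
  have hval : iteratedDeriv 2 (cgf X μ) 0 = Var[X; μ] := by
    rw [← variance_tilted_mul (huniv ▸ Set.mem_univ _)]
    simp
  obtain ⟨δ, hδ, hball⟩ := Metric.eventually_nhds_iff.1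
    (hcont.eventually_lt_const (hval.trans_lt hτ))
  refine ⟨δ, hδ, fun t ht htδ => ?_⟩
  rcases ht.eq_or_lt with rfl | ht
  · simp
  obtain ⟨u, hu, heq⟩ := exists_cgf_eq_iteratedDeriv_two_cgf_mul ht h0
    (huniv ▸ Set.subset_univ _)
  rw [← exp_cgf (hexp t), heq]
  have : iteratedDeriv 2 (cgf X μ) u ≤ τ := by
    refine (hball ?_).le
    rw [Real.dist_eq, sub_zero, abs_of_pos hu.1]
    exact hu.2.trans_le htδ
  gcongr

/-- Chernoff's bound at the Gaussian optimum `t = w / (τ√n)`; the restriction on `w` says exactly `t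
≤ δ` when `n > 0`. -/
lemma pi_real_le_exp (hX : Measurable X) (hexp : ∀ t, Integrable (fun ω => Real.exp (t * X ω)) μ)
    {τ δ : ℝ} (hτ : 0 < τ)
    (hδ : ∀ t, 0 ≤ t → t ≤ δ → mgf X μ t ≤ Real.exp (τ * t ^ 2 / 2)) (n : ℕ) {w : ℝ} (hw : 0 ≤ w)
    (hwn : w ≤ τ * δ * √n) :
    (Measure.pi fun _ : Fin n => μ).real {ω | w ≤ (∑ j, X (ω j)) / √n} ≤
      Real.exp (-(w ^ 2 / (2 * τ))) := by
  rcases n.eq_zero_or_pos with rfl | hn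
  · have : w = 0 := le_antisymm (by simpa using hwn) hw
    subst this
    simp
  have hn' : (0 : ℝ) < √n := Real.sqrt_pos.2 (Nat.cast_pos.2 hn)
  have hind : iIndepFun (fun (j : Fin n) (ω : Fin n → Ω) => X (ω j)) (Measure.pi fun _ => μ) :=
    iIndepFun_pi fun _ => hX.aemeasurable
  have hmp := fun j : Fin n => measurePreserving_eval (fun _ : Fin n => μ) j
  have hint : ∀ t (j : Fin n), Integrable (fun ω : Fin n → Ω => Real.exp (t * X (ω j)))
      (Measure.pi fun _ => μ) := fun t j => (hmp j).integrable_comp_of_integrable (hexp t)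
  set t := w / (τ * √n) with ht
  have ht0 : 0 ≤ t := by positivity
  have htδ : t ≤ δ := by
    rw [ht, div_le_iff₀ (by positivity)]
    linarith
  have hS : (∑ j : Fin n, fun ω : Fin n → Ω => X (ω j)) = fun ω => ∑ j, X (ω j) := by
    ext ω
    simp
  have hset : {ω : Fin n → Ω | w ≤ (∑ j, X (ω j)) / √n} =
      {ω | w * √n ≤ (∑ j : Fin n, fun ω : Fin n → Ω => X (ω j)) ω} := by
    ext ω
    simp only [Set.mem_ofPred_eq, le_div_iff₀ hn', hS]
  have hmgf : ∀ j : Fin n, mgf (fun ω : Fin n → Ω => X (ω j)) (Measure.pi fun _ => μ) t =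
      mgf X μ t := fun j => by
    have h := integral_map (φ := Function.eval j) (μ := Measure.pi fun _ : Fin n => μ)
      (measurable_pi_apply j).aemeasurable (f := fun x => Real.exp (t * X x))
      (by rw [(hmp j).map_eq]; exact (hexp t).aestronglyMeasurable)
    rw [(hmp j).map_eq] at h
    exact h.symm
  rw [hset]
  refine (measure_ge_le_exp_mul_mgf (w * √n) ht0 (hind.integrable_exp_mul_sum
    (fun _ => by fun_prop) fun j _ => hint t j)).trans ?_
  rw [hind.mgf_sum (fun _ => by fun_prop), Finset.prod_congr rfl fun j _ => hmgf j,
    Finset.prod_const, Finset.card_univ, Fintype.card_fin]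
  calc Real.exp (-t * (w * √n)) * mgf X μ t ^ n
      ≤ Real.exp (-t * (w * √n)) * Real.exp (τ * t ^ 2 / 2) ^ n := by
        gcongr
        · exact mgf_nonneg
        · exact hδ t ht0 htδ
    _ = Real.exp (-(w ^ 2 / (2 * τ))) := by
        rw [← Real.exp_nat_mul, ← Real.exp_add]
        congr 1
        have hsq : (n : ℝ) = √n ^ 2 := (Real.sq_sqrt n.cast_nonneg).symm
        rw [ht, hsq]
        field_simp
        rw [Real.sqrt_sq hn'.le]
        ring

/-- A Gaussian tail bound, in the moderate deviation range, for normalised sums of i.i.d. centred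
variables. -/
theorem exists_pi_real_abs_le_exp (hX : Measurable X)
    (hexp : ∀ t, Integrable (fun ω => Real.exp (t * X ω)) μ)
    (h0 : ∫ ω, X ω ∂μ = 0) {τ : ℝ} (hτ : Var[X; μ] < τ) :
    ∃ A > 0, ∀ n : ℕ, ∀ w, 0 ≤ w → w ≤ A * √n →
      (Measure.pi fun _ : Fin n => μ).real {ω | w ≤ |(∑ j, X (ω j)) / √n|} ≤
        2 * Real.exp (-(w ^ 2 / (2 * τ))) := by
  have hτ0 : 0 < τ := (variance_nonneg X μ).trans_lt hτ
  have hexp' : ∀ t, Integrable (fun ω => Real.exp (t * (-X) ω)) μ := fun t => by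
    simpa using hexp (-t)
  obtain ⟨δ₁, hδ₁, h₁⟩ := exists_mgf_le_exp_of_nonneg hexp h0 hτ
  obtain ⟨δ₂, hδ₂, h₂⟩ := exists_mgf_le_exp_of_nonneg (X := -X) hexp'
    (by simp [integral_neg, h0]) (by rwa [variance_neg])
  refine ⟨τ * min δ₁ δ₂, by positivity, fun n w hw hwn => ?_⟩
  have hw1 : w ≤ τ * δ₁ * √n := hwn.trans (by gcongr; exact min_le_left _ _)
  have hw2 : w ≤ τ * δ₂ * √n := hwn.trans (by gcongr; exact min_le_right _ _)
  have b1 := pi_real_le_exp hX hexp hτ0 h₁ n hw hw1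
  have b2 := pi_real_le_exp hX.neg hexp' hτ0 h₂ n hw hw2
  have hsub : {ω : Fin n → Ω | w ≤ |(∑ j, X (ω j)) / √n|} ⊆
      {ω | w ≤ (∑ j, X (ω j)) / √n} ∪ {ω | w ≤ (∑ j, (-X) (ω j)) / √n} := by
    intro ω hω
    rcases le_abs.1 hω.out with h | h
    · exact Or.inl h
    · refine Or.inr ?_
      simpa [Finset.sum_neg_distrib, neg_div] using h
  linarith [measureReal_mono (μ := Measure.pi fun _ : Fin n => μ) hsub,
    measureReal_union_le (μ := Measure.pi fun _ : Fin n => μ)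
      {ω | w ≤ (∑ j, X (ω j)) / √n} {ω | w ≤ (∑ j, (-X) (ω j)) / √n}]

end Product

/-! ### Weak convergence under the weight `exp(αx²)`. -/

lemma summable_exp_sq_sub {α θ : ℝ} (h : α < θ) :
    Summable fun k : ℕ => Real.exp (α * (k + 1) ^ 2) * (2 * Real.exp (-(θ * k ^ 2))) := by
  have hc : 0 < θ - α := sub_pos.2 h
  -- The maximum over real `k` of `α(k + 1)² - θk² + k`, found by completing the square; it gives
  -- domination by `e^{-k}`.
  set M := (2 * α + 1) ^ 2 / (4 * (θ - α)) + α with hM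
  refine Summable.of_nonneg_of_le (fun _ => by positivity) (fun k => ?_)
    (Real.summable_exp_neg_nat.mul_left (2 * Real.exp M))
  have : α * (k + 1) ^ 2 + -(θ * k ^ 2) ≤ M + -k := by
    have h1 : M + -k - (α * (k + 1) ^ 2 + -(θ * k ^ 2)) =
        (2 * (θ - α) * k - (2 * α + 1)) ^ 2 / (4 * (θ - α)) := by
      rw [hM]
      field_simp
      ring
    have h2 : 0 ≤ (2 * (θ - α) * k - (2 * α + 1)) ^ 2 / (4 * (θ - α)) := by positivity
    linarith
  calc Real.exp (α * (k + 1) ^ 2) * (2 * Real.exp (-(θ * k ^ 2)))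
      = 2 * Real.exp (α * (k + 1) ^ 2 + -(θ * k ^ 2)) := by rw [Real.exp_add]; ring
    _ ≤ 2 * Real.exp (M + -k) := by gcongr
    _ = 2 * Real.exp M * Real.exp (-k) := by rw [Real.exp_add]; ring

lemma integrableOn_mul_exp_sq {μ : Measure ℝ} [IsFiniteMeasure μ] {α : ℝ} (hα : 0 ≤ α) (r : ℝ) :
    IntegrableOn (fun x => Real.exp (α * x ^ 2)) {x | |x| ≤ r} μ := by
  refine Measure.integrableOn_of_bounded (M := Real.exp (α * r ^ 2)) (measure_ne_top _ _)
    (by fun_prop) ?_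
  refine (ae_restrict_iff' (measurableSet_le (by fun_prop) (by fun_prop))).2
    (Eventually.of_forall fun x hx => ?_)
  have : |x| ^ 2 ≤ r ^ 2 := pow_le_pow_left₀ (abs_nonneg x) hx 2
  rw [sq_abs] at this
  rw [Real.norm_eq_abs, Real.abs_exp]
  gcongr

/-- Truncated exponential square moments are bounded uniformly over measures with a common
Gaussian tail bound up to the truncation level. -/
lemma setIntegral_exp_sq_le {α θ : ℝ} (hα : 0 ≤ α) (h : α < θ) (μ : Measure ℝ)
    [IsProbabilityMeasure μ] (r : ℝ)
    (htail : ∀ w, 0 ≤ w → w ≤ r → μ.real {x | w ≤ |x|} ≤ 2 * Real.exp (-(θ * w ^ 2))) :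
    ∫ x in {x | |x| ≤ r}, Real.exp (α * x ^ 2) ∂μ ≤
      ∑' k : ℕ, Real.exp (α * (k + 1) ^ 2) * (2 * Real.exp (-(θ * k ^ 2))) := by
  have hS : MeasurableSet {x : ℝ | |x| ≤ r} := measurableSet_le (by fun_prop) (by fun_prop)
  have hT : ∀ k : ℕ, MeasurableSet {x : ℝ | k ≤ |x|} := fun k =>
    measurableSet_le (by fun_prop) (by fun_prop)
  rcases lt_or_ge r 0 with hr | hr
  · have : {x : ℝ | |x| ≤ r} = ∅ := by
      ext x
      simpa using hr.trans_le (abs_nonneg x)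
    rw [this, setIntegral_empty]
    exact tsum_nonneg fun _ => by positivity
  have hint : ∀ k : ℕ, Integrable ({x : ℝ | k ≤ |x|}.indicator
      fun _ => Real.exp (α * (k + 1) ^ 2)) μ := fun k =>
    (integrable_const _).indicator (hT k)
  calc ∫ x in {x | |x| ≤ r}, Real.exp (α * x ^ 2) ∂μ
      ≤ ∫ x in {x | |x| ≤ r}, ∑ k ∈ Finset.range (⌊r⌋₊ + 1),
          {x : ℝ | k ≤ |x|}.indicator (fun _ => Real.exp (α * (k + 1) ^ 2)) x ∂μ := by
        refine setIntegral_mono_on (integrableOn_mul_exp_sq hα r)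
          (integrable_finsetSum _ fun k _ => hint k).integrableOn hS fun x hx => ?_
        -- The single shell `k = ⌊|x|⌋` already dominates the integrand. Only `k ≤ ⌊r⌋` occur, so
        -- the tail bound is used within its range.
        have hk : ⌊|x|⌋₊ ∈ Finset.range (⌊r⌋₊ + 1) :=
          Finset.mem_range.2 (Nat.lt_succ_of_le (Nat.floor_mono hx))
        refine le_trans ?_ (Finset.single_le_sum (fun k _ => Set.indicator_nonneg
          (fun _ _ => (Real.exp_pos _).le) x) hk)
        rw [Set.indicator_of_mem (show x ∈ {y : ℝ | (⌊|x|⌋₊ : ℝ) ≤ |y|} from Nat.floor_le (abs_nonneg x)), ← sq_abs x]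
        have := (Nat.lt_floor_add_one |x|).le
        gcongr
    _ ≤ ∫ x, ∑ k ∈ Finset.range (⌊r⌋₊ + 1),
          {x : ℝ | k ≤ |x|}.indicator (fun _ => Real.exp (α * (k + 1) ^ 2)) x ∂μ :=
        setIntegral_le_integral (integrable_finsetSum _ fun k _ => hint k)
          (Eventually.of_forall fun x => Finset.sum_nonneg fun k _ => Set.indicator_nonneg
            (fun _ _ => (Real.exp_pos _).le) x)
    _ = ∑ k ∈ Finset.range (⌊r⌋₊ + 1),
          Real.exp (α * (k + 1) ^ 2) * μ.real {x : ℝ | k ≤ |x|} := by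
        rw [integral_finsetSum _ fun k _ => hint k]
        refine Finset.sum_congr rfl fun k _ => ?_
        rw [integral_indicator_const _ (hT k), smul_eq_mul, mul_comm]
    _ ≤ ∑ k ∈ Finset.range (⌊r⌋₊ + 1),
          Real.exp (α * (k + 1) ^ 2) * (2 * Real.exp (-(θ * k ^ 2))) := by
        refine Finset.sum_le_sum fun k hk => ?_
        have hkr : (k : ℝ) ≤ r :=
          (Nat.le_floor_iff hr).1 (Nat.lt_succ_iff.1 (Finset.mem_range.1 hk))
        gcongr
        exact htail k k.cast_nonneg hkr
    _ ≤ _ := (summable_exp_sq_sub h).sum_le_tsum _ fun _ _ => by positivity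

/-- A continuous cutoff, equal to `1` on `[-M, M]` and to `0` outside `[-M - 1, M + 1]`. -/
noncomputable def cutoff (M x : ℝ) : ℝ := max 0 (min 1 (M + 1 - |x|))

lemma continuous_cutoff (M : ℝ) : Continuous (cutoff M) := by
  unfold cutoff
  fun_prop

lemma cutoff_nonneg (M x : ℝ) : 0 ≤ cutoff M x := le_max_left _ _

lemma cutoff_le_one (M x : ℝ) : cutoff M x ≤ 1 := max_le zero_le_one (min_le_left _ _)

lemma cutoff_eq_one {M x : ℝ} (h : |x| ≤ M) : cutoff M x = 1 := by
  rw [cutoff, min_eq_left (by linarith), max_eq_right zero_le_one]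

lemma cutoff_eq_zero {M x : ℝ} (h : M + 1 ≤ |x|) : cutoff M x = 0 :=
  max_eq_left ((min_le_right _ _).trans (by linarith))

/-- Weak convergence is preserved when reweighting by a truncated Gaussian factor
`exp (α x²)`, provided a slightly larger truncated exponential moment is bounded. -/
theorem tendsto_setIntegral_mul_exp_sq {μ : ℕ → ProbabilityMeasure ℝ} {ν : ProbabilityMeasure ℝ}
    (h : Tendsto μ atTop (𝓝 ν)) {r : ℕ → ℝ} (hr : Tendsto r atTop atTop) {α α' C : ℝ}
    (hα : 0 ≤ α) (hαα' : α < α')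
    (hC : ∀ n, ∫ x in {x | |x| ≤ r n}, Real.exp (α' * x ^ 2) ∂(μ n : Measure ℝ) ≤ C)
    (hν : Integrable (fun x => Real.exp (α * x ^ 2)) (ν : Measure ℝ))
    (f : BoundedContinuousFunction ℝ ℝ) :
    Tendsto (fun n => ∫ x in {x | |x| ≤ r n}, f x * Real.exp (α * x ^ 2) ∂(μ n : Measure ℝ)) atTop
      (𝓝 (∫ x, f x * Real.exp (α * x ^ 2) ∂(ν : Measure ℝ))) := by
  have hS : ∀ s, MeasurableSet {x : ℝ | |x| ≤ s} := fun s =>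
    measurableSet_le (by fun_prop) (by fun_prop)
  have hbound : ∀ M x : ℝ, 0 ≤ M →
      ‖cutoff M x * (f x * Real.exp (α * x ^ 2))‖ ≤ ‖f‖ * Real.exp (α * (M + 1) ^ 2) := by
    intro M x hM
    rcases le_total (M + 1) |x| with hx | hx
    · rw [cutoff_eq_zero hx, zero_mul, norm_zero]
      positivity
    · have h2 : x ^ 2 ≤ (M + 1) ^ 2 := by
        rw [← sq_abs x]
        gcongr
      rw [norm_mul, norm_mul, Real.norm_eq_abs, abs_of_nonneg (cutoff_nonneg M x),
        Real.norm_eq_abs (Real.exp _), Real.abs_exp]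
      calc cutoff M x * (‖f x‖ * Real.exp (α * x ^ 2))
          ≤ 1 * (‖f‖ * Real.exp (α * (M + 1) ^ 2)) := by
            gcongr
            · exact cutoff_le_one M x
            · exact f.norm_coe_le_norm x
        _ = _ := one_mul _
  have hcont : ∀ M : ℝ, Continuous fun x => cutoff M x * (f x * Real.exp (α * x ^ 2)) :=
    fun M => (continuous_cutoff M).mul (f.continuous.mul (by fun_prop))
  have hintM : ∀ (M : ℝ) (P : ProbabilityMeasure ℝ), 0 ≤ M → Integrable
      (fun x => cutoff M x * (f x * Real.exp (α * x ^ 2))) (P : Measure ℝ) := fun M P hM =>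
    Integrable.of_bound (hcont M).aestronglyMeasurable _
      (Eventually.of_forall fun x => hbound M x hM)
  have hlimM : ∀ M : ℝ, 0 ≤ M → Tendsto
      (fun n => ∫ x, cutoff M x * (f x * Real.exp (α * x ^ 2)) ∂(μ n : Measure ℝ)) atTop
      (𝓝 (∫ x, cutoff M x * (f x * Real.exp (α * x ^ 2)) ∂(ν : Measure ℝ))) := fun M hM =>
    ProbabilityMeasure.tendsto_iff_forall_integral_tendsto.1 h
      (BoundedContinuousFunction.ofNormedAddCommGroup _ (hcont M) _ fun x => hbound M x hM)
  have hlim : Tendsto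
      (fun M : ℕ => ∫ x, cutoff M x * (f x * Real.exp (α * x ^ 2)) ∂(ν : Measure ℝ)) atTop
      (𝓝 (∫ x, f x * Real.exp (α * x ^ 2) ∂(ν : Measure ℝ))) := by
    refine tendsto_integral_of_dominated_convergence (fun x => ‖f‖ * Real.exp (α * x ^ 2))
      (fun M => (hcont M).aestronglyMeasurable) (hν.const_mul _)
      (fun M => Eventually.of_forall fun x => ?_) (Eventually.of_forall fun x => ?_)
    · rw [norm_mul, norm_mul, Real.norm_eq_abs, abs_of_nonneg (cutoff_nonneg M x),
        Real.norm_eq_abs (Real.exp _), Real.abs_exp]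
      calc cutoff M x * (‖f x‖ * Real.exp (α * x ^ 2))
          ≤ 1 * (‖f‖ * Real.exp (α * x ^ 2)) := by
            gcongr
            · exact cutoff_le_one _ x
            · exact f.norm_coe_le_norm x
        _ = _ := one_mul _
    · refine tendsto_const_nhds.congr' ?_
      filter_upwards [eventually_ge_atTop ⌈|x|⌉₊] with M hM
      rw [cutoff_eq_one ((Nat.le_ceil _).trans (Nat.cast_le.2 hM)), one_mul]
  -- The integrands agree for `|x| ≤ M`; beyond, `exp(αx²) ≤ exp(-(α' - α)M²) exp(α'x²)`. The error
  -- is thus small in `M`, uniformly in `n`.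
  have hdiff : ∀ (M : ℕ) (n : ℕ), (M : ℝ) + 1 ≤ r n →
      |∫ x in {x | |x| ≤ r n}, f x * Real.exp (α * x ^ 2) ∂(μ n : Measure ℝ) -
        ∫ x, cutoff M x * (f x * Real.exp (α * x ^ 2)) ∂(μ n : Measure ℝ)| ≤
      ‖f‖ * Real.exp (-((α' - α) * M ^ 2)) * C := by
    intro M n hMn
    have hrest : ∫ x, cutoff M x * (f x * Real.exp (α * x ^ 2)) ∂(μ n : Measure ℝ) =
        ∫ x in {x | |x| ≤ r n}, cutoff M x * (f x * Real.exp (α * x ^ 2)) ∂(μ n : Measure ℝ) := by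
      refine (setIntegral_eq_integral_of_forall_compl_eq_zero fun x hx => ?_).symm
      have hx' : r n < |x| := not_le.1 hx
      rw [cutoff_eq_zero (hMn.trans hx'.le), zero_mul]
    have hint : IntegrableOn (fun x => f x * Real.exp (α * x ^ 2)) {x | |x| ≤ r n}
        (μ n : Measure ℝ) :=
      (integrableOn_mul_exp_sq hα (r n)).bdd_mul f.continuous.aestronglyMeasurable
        (Eventually.of_forall f.norm_coe_le_norm)
    rw [hrest, ← integral_sub hint (hintM M (μ n) M.cast_nonneg).integrableOn, ← Real.norm_eq_abs]
    refine (norm_integral_le_of_norm_le (g := fun x => ‖f‖ * Real.exp (-((α' - α) * M ^ 2)) *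
      Real.exp (α' * x ^ 2)) ((integrableOn_mul_exp_sq (hα.trans hαα'.le) (r n)).const_mul _)
      (Eventually.of_forall fun x => ?_)).trans ?_
    · rcases le_total |x| M with hx | hx
      · rw [cutoff_eq_one hx, one_mul, sub_self, norm_zero]
        positivity
      · have h1 : f x * Real.exp (α * x ^ 2) - cutoff M x * (f x * Real.exp (α * x ^ 2)) =
            (1 - cutoff M x) * (f x * Real.exp (α * x ^ 2)) := by ring
        have h2 : (M : ℝ) ^ 2 ≤ x ^ 2 := by
          rw [← sq_abs x]
          gcongr
        have h3 : 0 ≤ (α' - α) * (x ^ 2 - M ^ 2) :=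
          mul_nonneg (sub_pos.2 hαα').le (sub_nonneg.2 h2)
        rw [h1, norm_mul, norm_mul, Real.norm_eq_abs,
          abs_of_nonneg (sub_nonneg.2 (cutoff_le_one _ x)), Real.norm_eq_abs (Real.exp _),
          Real.abs_exp, mul_assoc, ← Real.exp_add]
        calc (1 - cutoff M x) * (‖f x‖ * Real.exp (α * x ^ 2))
            ≤ 1 * (‖f‖ * Real.exp (-((α' - α) * M ^ 2) + α' * x ^ 2)) := by
              gcongr
              · linarith [cutoff_nonneg M x]
              · exact f.norm_coe_le_norm x
              · linarith
          _ = _ := one_mul _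
    · rw [integral_const_mul]
      gcongr
      exact hC n
  have hsmall : Tendsto (fun M : ℕ => ‖f‖ * Real.exp (-((α' - α) * (M : ℝ) ^ 2)) * C) atTop
      (𝓝 0) := by
    have h1 : Tendsto (fun M : ℕ => (α' - α) * (M : ℝ) ^ 2) atTop atTop :=
      ((tendsto_pow_atTop two_ne_zero).comp tendsto_natCast_atTop_atTop).const_mul_atTop
        (sub_pos.2 hαα')
    simpa using ((Real.tendsto_exp_neg_atTop_nhds_zero.comp h1).const_mul ‖f‖).mul_const C
  refine Metric.tendsto_atTop'.2 fun ε hε => ?_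
  obtain ⟨M, hM1, hM2⟩ := ((hsmall.eventually_lt_const (show (0 : ℝ) < ε / 3 by positivity)).and
    (Metric.tendsto_nhds.1 hlim (ε / 3) (by positivity))).exists
  obtain ⟨N, hN⟩ := eventually_atTop.1 ((hr.eventually_ge_atTop ((M : ℝ) + 1)).and
    (Metric.tendsto_nhds.1 (hlimM M M.cast_nonneg) (ε / 3) (by positivity)))
  refine ⟨N, fun n hn => ?_⟩
  have a1 := hdiff M n (hN n hn.le).1
  have a2 := (hN n hn.le).2
  rw [← Real.dist_eq] at a1
  refine (dist_triangle4 _ _ _ _).trans_lt ((add_lt_add (add_lt_add_of_le_of_lt a1 a2) hM2).trans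
    ?_)
  linarith

/-- The exponents add: `1/v - 2α` is the inverse of the new variance. -/
lemma gaussianPDFReal_mul_exp_sq {v α : ℝ} (hv : 0 < v) (h : 2 * α * v < 1) (x : ℝ) :
    gaussianPDFReal 0 v.toNNReal x * Real.exp (α * x ^ 2) =
      ((√(2 * Real.pi * v))⁻¹ * √(2 * Real.pi * (v / (1 - 2 * α * v)))) *
        gaussianPDFReal 0 (v / (1 - 2 * α * v)).toNNReal x := by
  have h1 : 0 < 1 - 2 * α * v := sub_pos.2 h
  have hv' : 0 < v / (1 - 2 * α * v) := div_pos hv h1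
  have hs : √(2 * Real.pi * (v / (1 - 2 * α * v))) ≠ 0 := by positivity
  rw [gaussianPDFReal_def, gaussianPDFReal_def, Real.coe_toNNReal _ hv.le,
    Real.coe_toNNReal _ hv'.le]
  dsimp only
  rw [mul_assoc (√(2 * Real.pi * v))⁻¹ (Real.exp _), mul_assoc (√(2 * Real.pi * v))⁻¹,
    mul_inv_cancel_left₀ hs, ← Real.exp_add]
  congr 2
  field_simp
  ring

lemma integral_gaussianReal_mul_exp_sq {v α : ℝ} (hv : 0 < v) (h : 2 * α * v < 1) (f : ℝ → ℝ) :
    ∫ x, f x * Real.exp (α * x ^ 2) ∂gaussianReal 0 v.toNNReal =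
      ((√(2 * Real.pi * v))⁻¹ * √(2 * Real.pi * (v / (1 - 2 * α * v)))) *
        ∫ x, f x ∂gaussianReal 0 (v / (1 - 2 * α * v)).toNNReal := by
  have hv' : 0 < v / (1 - 2 * α * v) := div_pos hv (sub_pos.2 h)
  rw [integral_gaussianReal_eq_integral_smul (Real.toNNReal_pos.2 hv).ne',
    integral_gaussianReal_eq_integral_smul (Real.toNNReal_pos.2 hv').ne', ← integral_const_mul]
  refine integral_congr_ae (Eventually.of_forall fun x => ?_)
  simp only [smul_eq_mul]
  linear_combination f x * gaussianPDFReal_mul_exp_sq hv h x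

lemma integrable_exp_sq_gaussianReal {v α : ℝ} (hv : 0 < v) (h : 2 * α * v < 1) :
    Integrable (fun x => Real.exp (α * x ^ 2)) (gaussianReal 0 v.toNNReal) := by
  rw [gaussianReal_of_var_ne_zero _ (Real.toNNReal_pos.2 hv).ne', gaussianPDF_def,
    integrable_withDensity_iff_integrable_smul' (by fun_prop)
      (Eventually.of_forall fun _ => ENNReal.ofReal_lt_top)]
  simp only [ENNReal.toReal_ofReal (gaussianPDFReal_nonneg _ _ _), smul_eq_mul,
    gaussianPDFReal_mul_exp_sq hv h]
  exact (integrable_gaussianPDFReal _ _).const_mul _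

/-! ### The canonical ensemble as a reweighted product measure. -/

lemma pi_tilted {ι Ω : Type*} [Fintype ι] [Finite Ω] [MeasurableSpace Ω]
    [MeasurableSingletonClass Ω] (μ : Measure Ω) [IsProbabilityMeasure μ] (f : Ω → ℝ) :
    Measure.pi (fun _ : ι => μ.tilted f) =
      (Measure.pi fun _ : ι => μ).tilted fun ω => ∑ i, f (ω i) := by
  have : IsProbabilityMeasure (μ.tilted f) := isProbabilityMeasure_tilted Integrable.of_finite
  refine Measure.ext_of_singleton fun ω => ?_
  have hZ : ∫ ω : ι → Ω, Real.exp (∑ i, f (ω i)) ∂(Measure.pi fun _ => μ) =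
      ∏ _i : ι, ∫ x, Real.exp (f x) ∂μ := by
    simp only [Real.exp_sum]
    exact integral_fintype_prod_eq_prod fun _ x => Real.exp (f x)
  rw [Measure.pi_singleton, tilted_apply, lintegral_singleton, Measure.pi_singleton, hZ,
    Real.exp_sum, ← Finset.prod_div_distrib, ENNReal.ofReal_prod_of_nonneg fun _ _ => by positivity,
    ← Finset.prod_mul_distrib]
  refine Finset.prod_congr rfl fun i _ => ?_
  rw [tilted_apply, lintegral_singleton]

lemma tilted_add_const {Ω : Type*} [MeasurableSpace Ω] {μ : Measure Ω} [NeZero μ] {f : Ω → ℝ}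
    (hf : Integrable (fun x => Real.exp (f x)) μ) (c : ℝ) :
    (μ.tilted fun x => f x + c) = μ.tilted f := by
  have := isProbabilityMeasure_tilted hf
  conv_rhs => rw [← tilted_const (μ.tilted f) c, tilted_tilted hf]
  rfl

/-- The single-site law `ρ_β` tilted by `exp (u x)`. -/
noncomputable def siteLaw (β u : ℝ) : Measure Spin := (rhoBeta β).tilted fun x => u * (x : ℝ)

instance (β u : ℝ) : IsProbabilityMeasure (siteLaw β u) :=
  isProbabilityMeasure_tilted Integrable.of_finite

lemma integral_siteLaw (β u : ℝ) : ∫ x : Spin, (x : ℝ) ∂siteLaw β u = cumulantDeriv β u := by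
  have huniv : integrableExpSet (fun x : Spin => (x : ℝ)) (rhoBeta β) = Set.univ :=
    Set.eq_univ_of_forall fun _ => Integrable.of_finite
  rw [siteLaw, integral_tilted_mul_self (by simp [huniv])]
  exact (hasDerivAt_cumulant β u).deriv

lemma variance_siteLaw (β u : ℝ) :
    Var[fun x : Spin => (x : ℝ); siteLaw β u] = cumulantDeriv₂ β u := by
  have huniv : integrableExpSet (fun x : Spin => (x : ℝ)) (rhoBeta β) = Set.univ :=
    Set.eq_univ_of_forall fun _ => Integrable.of_finite
  rw [siteLaw, variance_tilted_mul (by simp [huniv])]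
  exact iteratedDeriv_two_cumulant β u

/-- The normalised fluctuation `(Sₙ - n z) / √n` of the total spin. -/
noncomputable def fluctuation (z : ℝ) {n : ℕ} (ω : Config n) : ℝ := (totalSpin ω - n * z) / √n

/-- The canonical ensemble is a Gaussian reweighting of the product of tilted single-site laws. -/
lemma canonicalEnsemble_eq_tilted (β K z : ℝ) {n : ℕ} (hn : n ≠ 0) :
    canonicalEnsemble β K n =
      (Measure.pi fun _ : Fin n => siteLaw β (2 * β * K * z)).tilted
        fun ω => β * K * fluctuation z ω ^ 2 := by
  have hP : IsProbabilityMeasure (productMeasure n) := by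
    unfold productMeasure
    infer_instance
  have hsite : siteLaw β (2 * β * K * z) =
      rho.tilted fun x : Spin => -(β * (x : ℝ) ^ 2) + 2 * β * K * z * x := by
    rw [siteLaw, rhoBeta_eq_tilted, tilted_tilted Integrable.of_finite]
    rfl
  rw [hsite, pi_tilted, tilted_tilted Integrable.of_finite]
  change (productMeasure n).tilted _ = (productMeasure n).tilted _
  -- Since `W² = S²/n - 2zS + nz²`, the two exponents differ by the constant `nβKz²`, which
  -- normalization absorbs.
  rw [← tilted_add_const Integrable.of_finite (n * (β * K * z ^ 2))]
  congr 1
  ext ω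
  have hn' : (n : ℝ) ≠ 0 := Nat.cast_ne_zero.2 hn
  simp only [energyPerParticle, hamiltonian, Pi.add_apply, fluctuation, totalSpin, div_pow,
    Real.sq_sqrt n.cast_nonneg, Finset.sum_add_distrib, Finset.sum_neg_distrib, ← Finset.mul_sum]
  field_simp
  ring

lemma spinEvent_eq_preimage (z a : ℝ) {n : ℕ} (hn : n ≠ 0) :
    spinEvent z a n = fluctuation z ⁻¹' {x | |x| ≤ a * √n} := by
  ext ω
  have h0 : (0 : ℝ) < n := Nat.cast_pos.2 (Nat.pos_of_ne_zero hn)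
  have hn' : (0 : ℝ) < √n := Real.sqrt_pos.2 h0
  have hsq : √(n : ℝ) * √n = n := Real.mul_self_sqrt n.cast_nonneg
  have h1 : totalSpin ω / n - z = (totalSpin ω - n * z) / n := by
    field_simp
  simp only [spinEvent, Set.mem_ofPred_eq, Set.mem_preimage, fluctuation]
  rw [← Set.mem_Icc_iff_abs_le, abs_sub_comm, h1, abs_div, abs_div, abs_of_pos hn', abs_of_pos h0,
    div_le_iff₀ h0, div_le_iff₀ hn', mul_assoc, hsq]

/-- The truncated, reweighted expectation of `f` under the fluctuation law of the product of tilted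
single-site laws. -/
noncomputable def truncatedIntegral (β K z a : ℝ) (f : ℝ → ℝ) (n : ℕ) : ℝ :=
  ∫ x in {x | |x| ≤ a * √n}, f x * Real.exp (β * K * x ^ 2)
    ∂((Measure.pi fun _ : Fin n => siteLaw β (2 * β * K * z)).map (fluctuation z))

lemma setIntegral_canonicalEnsemble (β K z a : ℝ) {f : ℝ → ℝ} (hf : Measurable f) {n : ℕ}
    (hn : n ≠ 0) :
    ∫ ω in spinEvent z a n, f (fluctuation z ω) ∂canonicalEnsemble β K n =
      (∫ ω, Real.exp (β * K * fluctuation z ω ^ 2)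
        ∂(Measure.pi fun _ : Fin n => siteLaw β (2 * β * K * z)))⁻¹ *
          truncatedIntegral β K z a f n := by
  rw [truncatedIntegral, setIntegral_map (measurableSet_le (by fun_prop) (by fun_prop))
    (Measurable.aestronglyMeasurable (by fun_prop)) (measurable_of_finite _).aemeasurable,
    ← spinEvent_eq_preimage z a hn, canonicalEnsemble_eq_tilted β K z hn,
    setIntegral_tilted' _ _ (Set.toFinite _).measurableSet, ← integral_const_mul]
  refine integral_congr_ae (Eventually.of_forall fun ω => ?_)
  simp only [smul_eq_mul]
  ring

lemma real_canonicalEnsemble_spinEvent (β K z a : ℝ) {n : ℕ} (hn : n ≠ 0) :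
    (canonicalEnsemble β K n).real (spinEvent z a n) =
      (∫ ω, Real.exp (β * K * fluctuation z ω ^ 2)
        ∂(Measure.pi fun _ : Fin n => siteLaw β (2 * β * K * z)))⁻¹ *
          truncatedIntegral β K z a (fun _ => 1) n := by
  rw [← setIntegral_canonicalEnsemble β K z a measurable_const hn]
  simp

/-- The normalization of the weight cancels between numerator and conditioning probability, so its
asymptotics are never needed. -/
lemma integral_condLaw (β K z a : ℝ) {f : ℝ → ℝ} (hf : Measurable f) {n : ℕ} (hn : n ≠ 0) :
    ∫ x, f x ∂(condLaw β K z a n : Measure ℝ) =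
      truncatedIntegral β K z a f n / truncatedIntegral β K z a (fun _ => 1) n := by
  have hZ : 0 < ∫ ω, Real.exp (β * K * fluctuation z ω ^ 2)
      ∂(Measure.pi fun _ : Fin n => siteLaw β (2 * β * K * z)) :=
    integral_exp_pos Integrable.of_finite
  change ∫ x, f x ∂((cond (canonicalEnsemble β K n) (spinEvent z a n)).map (fluctuation z)) = _
  rw [integral_map (measurable_of_finite _).aemeasurable hf.aestronglyMeasurable, ProbabilityTheory.cond,
    integral_smul_measure, setIntegral_canonicalEnsemble β K z a hf hn, ENNReal.toReal_inv,
    ← measureReal_def, real_canonicalEnsemble_spinEvent β K z a hn, smul_eq_mul, mul_inv, inv_inv]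
  field_simp

/-! ### The conditional limit theorem. -/

/-- At a nondegenerate critical point, the truncated reweighted integrals converge for every small
truncation parameter. -/
lemma exists_tendsto_truncatedIntegral {β K z : ℝ} (hβ : 0 < β) (hK : 0 < K)
    (hz : cumulantDeriv β (2 * β * K * z) = z) {v : ℝ} (hv : cumulantDeriv₂ β (2 * β * K * z) = v)
    (hv1 : 2 * (β * K) * v < 1) :
    ∃ A > 0, ∀ a ∈ Set.Ioo (0 : ℝ) A, ∀ f : BoundedContinuousFunction ℝ ℝ,
      Tendsto (truncatedIntegral β K z a f) atTop
        (𝓝 (((√(2 * Real.pi * v))⁻¹ * √(2 * Real.pi * (v / (1 - 2 * (β * K) * v)))) *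
          ∫ x, f x ∂gaussianReal 0 (v / (1 - 2 * (β * K) * v)).toNNReal)) := by
  have hα : 0 < β * K := mul_pos hβ hK
  have hv0 : 0 < v := hv ▸ cumulantDeriv₂_pos _ _
  -- The gap `2βKv < 1` leaves room for both a tail variance `τ > v` and an exponent `α' > βK` with
  -- `α' < 1/(2τ)`, the decay rate of the tail.
  obtain ⟨τ, hτ1, hτ2⟩ : ∃ τ, v < τ ∧ τ < 1 / (2 * (β * K)) :=
    exists_between (by rw [lt_div_iff₀ (by positivity)]; linarith)
  have hτ0 : 0 < τ := hv0.trans hτ1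
  obtain ⟨α', hα1, hα2⟩ : ∃ α', β * K < α' ∧ α' < 1 / (2 * τ) := by
    refine exists_between ?_
    rw [lt_div_iff₀ (by positivity)] at hτ2 ⊢
    linarith
  have hmean := (integral_siteLaw β (2 * β * K * z)).trans hz
  have hvar := (variance_siteLaw β (2 * β * K * z)).trans hv
  obtain ⟨A, hA, htail⟩ := exists_pi_real_abs_le_exp (μ := siteLaw β (2 * β * K * z))
    (X := fun x : Spin => (x : ℝ) - z) (by fun_prop) (fun _ => Integrable.of_finite)
    (by rw [integral_sub Integrable.of_finite Integrable.of_finite, hmean]; simp)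
    (τ := τ) (by rwa [variance_sub_const (Measurable.aestronglyMeasurable (by fun_prop)), hvar])
  refine ⟨A, hA, fun a ha f => ?_⟩
  have hclt := tendsto_map_pi_gaussianReal (μ := siteLaw β (2 * β * K * z))
    (X := fun x : Spin => (x : ℝ)) (by fun_prop) (MemLp.of_discrete)
  simp only [hvar, hmean] at hclt
  have hr : Tendsto (fun n : ℕ => a * √(n : ℝ)) atTop atTop :=
    (Real.tendsto_sqrt_atTop.comp tendsto_natCast_atTop_atTop).const_mul_atTop ha.1
  have hbound : ∀ n : ℕ, ∫ x in {x | |x| ≤ a * √n}, Real.exp (α' * x ^ 2)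
      ∂((Measure.pi fun _ : Fin n => siteLaw β (2 * β * K * z)).map (fluctuation z)) ≤
      ∑' k : ℕ, Real.exp (α' * (k + 1) ^ 2) * (2 * Real.exp (-(1 / (2 * τ) * k ^ 2))) := by
    intro n
    have : IsProbabilityMeasure
        ((Measure.pi fun _ : Fin n => siteLaw β (2 * β * K * z)).map (fluctuation z)) :=
      Measure.isProbabilityMeasure_map (measurable_of_finite _).aemeasurable
    refine setIntegral_exp_sq_le (hα.le.trans hα1.le) hα2 _ _ fun w hw hwr => ?_
    have h := htail n w hw (hwr.trans (by gcongr; exact ha.2.le))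
    rw [map_measureReal_apply (measurable_of_finite _)
      (measurableSet_le (by fun_prop) (by fun_prop))]
    convert! h using 2
    · ext ω
      simp [fluctuation, totalSpin, Finset.sum_sub_distrib]
    · congr 1
      ring
  rw [← integral_gaussianReal_mul_exp_sq hv0 hv1]
  exact tendsto_setIntegral_mul_exp_sq hclt hr hα.le hα1 hbound
    (integrable_exp_sq_gaussianReal hv0 hv1) f

theorem exists_tendsto_condLaw {β K z : ℝ} (hβ : 0 < β) (hK : 0 < K)
    (hz : cumulantDeriv β (2 * β * K * z) = z) (hG : 0 < freeGDeriv₂ β K z) :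
    0 < limitVariance β K z ∧
    ∃ A : ℝ, 0 < A ∧ ∀ a ∈ Set.Ioo (0 : ℝ) A,
      (∀ᶠ n : ℕ in atTop, canonicalEnsemble β K n (spinEvent z a n) ≠ 0) ∧
      Tendsto (fun n : ℕ => condLaw β K z a n) atTop
        (𝓝 (normalLaw (limitVariance β K z))) := by
  obtain ⟨v, hv⟩ : ∃ v, cumulantDeriv₂ β (2 * β * K * z) = v := ⟨_, rfl⟩
  have hv0 : 0 < v := hv ▸ cumulantDeriv₂_pos _ _
  have hk : 0 < 2 * β * K := by positivity
  have hv1 : 2 * (β * K) * v < 1 := by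
    rw [freeGDeriv₂, hv] at hG
    have := (mul_pos_iff_of_pos_left hk).1 hG
    linarith
  have hσ : limitVariance β K z = v / (1 - 2 * (β * K) * v) := by
    rw [limitVariance, iteratedDeriv_two_cumulant, iteratedDeriv_two_freeG, freeGDeriv₂, hv,
      mul_div_mul_left _ _ hk.ne', ← mul_assoc 2 β K]
  have hσ0 : 0 < v / (1 - 2 * (β * K) * v) := div_pos hv0 (sub_pos.2 hv1)
  obtain ⟨A, hA, hlim⟩ := exists_tendsto_truncatedIntegral hβ hK hz hv hv1
  rw [hσ]
  refine ⟨hσ0, A, hA, fun a ha => ?_⟩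
  -- The limit for `f = 1`. Its positivity gives both the eventual positivity of the event and the
  -- limit of the quotient.
  have hc : 0 < (√(2 * Real.pi * v))⁻¹ * √(2 * Real.pi * (v / (1 - 2 * (β * K) * v))) := by
    positivity
  have hone : Tendsto (truncatedIntegral β K z a fun _ => 1) atTop
      (𝓝 ((√(2 * Real.pi * v))⁻¹ * √(2 * Real.pi * (v / (1 - 2 * (β * K) * v))))) := by
    simpa using hlim a ha (BoundedContinuousFunction.const ℝ 1)
  constructor
  · filter_upwards [hone.eventually_const_lt hc, eventually_ne_atTop 0] with n hpos hn h0
    have h := real_canonicalEnsemble_spinEvent β K z a hn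
    rw [measureReal_def, h0, ENNReal.toReal_zero] at h
    have hZ : 0 < ∫ ω, Real.exp (β * K * fluctuation z ω ^ 2)
        ∂(Measure.pi fun _ : Fin n => siteLaw β (2 * β * K * z)) :=
      integral_exp_pos Integrable.of_finite
    exact (mul_pos (inv_pos.2 hZ) hpos).ne h
  · refine FiniteMeasure.tendsto_iff_forall_integral_tendsto.2 fun f => ?_
    have h := (hlim a ha f).div hone hc.ne'
    rw [mul_div_cancel_left₀ _ hc.ne'] at h
    refine h.congr' ?_
    filter_upwards [eventually_ne_atTop 0] with n hn
    exact (integral_condLaw β K z a f.continuous.measurable hn).symm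

end BEG

theorem mainTheorem11 (β K : ℝ) (hβ : 0 < β) (hK : 0 < K) :
    BEG.macrostates β K = {z : ℝ | ∀ y : ℝ, BEG.freeG β K z ≤ BEG.freeG β K y} ∧
    ∀ (m : ℕ) (_ : m = 2 ∨ m = 3) (z : Fin m → ℝ) (_ : Function.Injective z)
      (_ : BEG.macrostates β K = Set.range z) (j : Fin m),
      0 < iteratedDeriv 2 (BEG.freeG β K) (z j) ∧
      0 < BEG.limitVariance β K (z j) ∧
      ∃ A : ℝ, 0 < A ∧ ∀ a ∈ Set.Ioo (0 : ℝ) A,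
        (∀ᶠ n : ℕ in atTop, BEG.canonicalEnsemble β K n (BEG.spinEvent (z j) a n) ≠ 0) ∧
        Tendsto (fun n : ℕ => BEG.condLaw β K (z j) a n) atTop
          (𝓝 (BEG.normalLaw (BEG.limitVariance β K (z j)))) := by
  refine ⟨BEG.macrostates_eq hβ hK, fun m hm z hinj hz j => ?_⟩
  rw [BEG.macrostates_eq hβ hK] at hz
  have hj : z j ∈ {z : ℝ | ∀ y : ℝ, BEG.freeG β K z ≤ BEG.freeG β K y} :=
    hz ▸ Set.mem_range_self j
  have hnt : (Set.range z).Nontrivial := by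
    have : Nontrivial (Fin m) := Fin.nontrivial_iff_two_le.2 (by omega)
    obtain ⟨i, k, hik⟩ := exists_pair_ne (Fin m)
    exact ⟨z i, ⟨i, rfl⟩, z k, ⟨k, rfl⟩, hinj.ne hik⟩
  have hG := BEG.freeGDeriv₂_pos hβ hK (hz ▸ Set.finite_range z) (hz ▸ hnt) hj
  rw [BEG.iteratedDeriv_two_freeG]
  exact ⟨hG, BEG.exists_tendsto_condLaw hβ hK (BEG.cumulantDeriv_eq_of_isMin hβ hK hj) hG⟩
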